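/- Let $\varpi:\mathbb{R}\to[0,\infty)$ be a normalized weight function ($\int_{\mathbb R}\varpi\,dx=1$, all moments finite), and let $p_n(x)=a_nx^n+b_nx^{n-1}+\cdots$, $a_n\neq0$, $n\ge 0$ (with $b_0=0$), be orthonormal polynomials for it: $\int p_mp_n\varpi\,dx=\delta_{mn}$. Put $$\alpha_n=\frac{a_n}{a_{n+1}},\qquad \beta_n=\frac{b_n}{a_n}-\frac{b_{n+1}}{a_{n+1}},$$ and assume the exponential growth conditions $$\alpha_n=\xi n^t(1+\xi_n),\qquad \beta_n=\zeta n^t(1+\zeta_n)+\eta_n\qquad(n\ge1),$$ where $\xi\ne0$, $\zeta\ge0$, $0\le t\le1$ are constants and $\xi_n,\zeta_n,\eta_n\to0$ as $n\to\infty$. Let $$D_n=\int_{\mathbb R}x^2\,\frac1n\sum_{m=0}^{n-1}p_m^2(x)\varpi(x)\,dx ,$$ and let $\sigma$ be a probability density on $\mathbb R$ whose $k$-th moments, for $k=1,2,\dots$, are finite and equal to $$M^{(k)}=\frac{\sum_{i=0}^{\lfloor k/2\rfloor}\binom ki\binom{k-i}{i}\xi^{2i}\zeta^{k-2i}}{(2\xi^2+\zeta^2)^{k/2}}\cdot\frac{(2t+1)^{k/2}}{kt+1}$$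 (with $0^0=1$); this $\sigma$ is the level density of the unperturbed ensemble. Let $p$ be a fixed nonzero real polynomial, of any degree, and let $\hat p_0,\hat p_1,\dots$ (with $\deg\hat p_j=j$) be orthonormal polynomials for the weight $p^2\varpi$, i.e. $\int\hat p_i\hat p_j\,p^2\varpi\,dx=\delta_{ij}$. Put $$\hat R_n(x)=\sum_{j=0}^{n-1}\hat p_j^2(x)p^2(x)\varpi(x),\qquad \hat\sigma_n(x)=\frac{\sqrt{D_n}}{n}\,\hat R_n\bigl(x\sqrt{D_n}\bigr).$$ Then $\hat\sigma_n$ is a probability density for every $n\ge1$, and $\hat\sigma_n$ converges weakly to $\sigma$ as $n\to\infty$: for every bounded continuous $f:\mathbb R\to\mathbb R$, $$\lim_{n\to\infty}\int_{\mathbb R}f(x)\hat\sigma_n(x)\,dx=\int_{\mathbb R}f(x)\sigma(x)\,dx .$$ -/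

import Mathlib

open MeasureTheory Filter Topology Polynomial BoundedContinuousFunction

noncomputable section

namespace LevelDensity

/-- `f` is a probability density on the real line (with respect to Lebesgue measure). -/
structure IsProbDensity (f : ℝ → ℝ) : Prop where
  nonneg : ∀ x, 0 ≤ f x
  integrable : Integrable f
  integral_eq_one : ∫ x, f x = 1

/-- A normalized weight function on the real line: a probability density all of whose moments
are finite. It may vanish on parts of the line, so weights on intervals are included. -/
structure IsNormalizedWeight (w : ℝ → ℝ) : Prop extends IsProbDensity w where
  integrable_pow : ∀ k : ℕ, Integrable (fun x => x ^ k * w x)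

/-- `P 0, P 1, P 2, …` are normalized orthogonal polynomials for the weight `w`
(`P n` has degree exactly `n`; they are unique up to the choice of the signs of their
leading coefficients). -/
structure IsOrthonormalPolys (w : ℝ → ℝ) (P : ℕ → ℝ[X]) : Prop where
  degree_eq : ∀ n, (P n).degree = n
  orthonormal : ∀ m n, ∫ x, (P m).eval x * (P n).eval x * w x = if m = n then 1 else 0

/-- The recurrence coefficient `α_n = a_n / a_{n+1}`, where `a_n` is the leading coefficient of
`P n`. -/
def recAlpha (P : ℕ → ℝ[X]) (n : ℕ) : ℝ :=
  (P n).leadingCoeff / (P (n + 1)).leadingCoeff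

/-- The recurrence coefficient `β_n = b_n / a_n - b_{n+1} / a_{n+1}`, where
`P n = a_n x^n + b_n x^(n-1) + ⋯` (and `b_0 = 0`). -/
def recBeta (P : ℕ → ℝ[X]) (n : ℕ) : ℝ :=
  (P n).nextCoeff / (P n).leadingCoeff - (P (n + 1)).nextCoeff / (P (n + 1)).leadingCoeff

/-- The exponential growth conditions with constants `ξ`, `ζ`, `t`. -/
def ExpGrowth (ξ ζ t : ℝ) (α β : ℕ → ℝ) : Prop :=
  ξ ≠ 0 ∧ 0 ≤ ζ ∧ 0 ≤ t ∧ t ≤ 1 ∧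
  ∃ ξ' ζ' η' : ℕ → ℝ,
    Tendsto ξ' atTop (𝓝 0) ∧ Tendsto ζ' atTop (𝓝 0) ∧ Tendsto η' atTop (𝓝 0) ∧
    ∀ n : ℕ, 1 ≤ n →
      α n = ξ * (n : ℝ) ^ t * (1 + ξ' n) ∧ β n = ζ * (n : ℝ) ^ t * (1 + ζ' n) + η' n

/-- The one-level correlation function `R_n(x) = ∑_{m < n} P_m(x)^2 w(x)`. -/
def oneLevel (w : ℝ → ℝ) (P : ℕ → ℝ[X]) (n : ℕ) (x : ℝ) : ℝ :=
  ∑ m ∈ Finset.range n, (P m).eval x ^ 2 * w x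

/-- `D_n`, the second moment of the density `R_n / n`. -/
def secondMoment (w : ℝ → ℝ) (P : ℕ → ℝ[X]) (n : ℕ) : ℝ :=
  ∫ x, x ^ 2 * (1 / (n : ℝ) * oneLevel w P n x)

/-- The perturbed weight `q^2 w`. -/
def perturbedWeight (w : ℝ → ℝ) (q : ℝ[X]) (x : ℝ) : ℝ :=
  q.eval x ^ 2 * w x

/-- The rescaled one-level density of the perturbed ensemble,
`(√D_n / n) R̂_n(x √D_n)`. Here `R̂_n` belongs to the weight `q^2 w` and its orthonormal
polynomials `Q`, while `D_n` belongs to the unperturbed weight `w` and its polynomials `P`. -/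
def perturbedDensity (w : ℝ → ℝ) (P : ℕ → ℝ[X]) (q : ℝ[X]) (Q : ℕ → ℝ[X]) (n : ℕ) (x : ℝ) : ℝ :=
  √(secondMoment w P n) / (n : ℝ) *
    oneLevel (perturbedWeight w q) Q n (x * √(secondMoment w P n))

/-- The numbers
`M^(k) = (r₁(k) / r₂(k)) (2t+1)^(k/2) / (kt+1)` with
`r₁(k) = ∑_{i ≤ k/2} C(k,i) C(k-i,i) ξ^(2i) ζ^(k-2i)` and `r₂(k) = (2ξ²+ζ²)^(k/2)`. -/
def levelMoment (ξ ζ t : ℝ) (k : ℕ) : ℝ :=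
  (∑ i ∈ Finset.range (k / 2 + 1),
      (k.choose i : ℝ) * ((k - i).choose i : ℝ) * ξ ^ (2 * i) * ζ ^ (k - 2 * i))
    / (2 * ξ ^ 2 + ζ ^ 2) ^ ((k : ℝ) / 2)
    * ((2 * t + 1) ^ ((k : ℝ) / 2) / ((k : ℝ) * t + 1))

/-- `σ` is a probability density with finite moments `M^(k)`, `k = 1, 2, …`. -/
def IsLevelDensity (ξ ζ t : ℝ) (σ : ℝ → ℝ) : Prop :=
  IsProbDensity σ ∧
  ∀ k : ℕ, 1 ≤ k →
    Integrable (fun x => x ^ k * σ x) ∧ ∫ x, x ^ k * σ x = levelMoment ξ ζ t k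

/-- Weak convergence of densities: convergence of the integrals of every bounded continuous
function. -/
def WeaklyConverges (f : ℕ → ℝ → ℝ) (σ : ℝ → ℝ) : Prop :=
  ∀ φ : ℝ →ᵇ ℝ, Tendsto (fun n => ∫ x, φ x * f n x) atTop (𝓝 (∫ x, φ x * σ x))

end LevelDensity

end

/-! The products `q * Q j` with `j < n` are orthonormal for `w` and have degree below `n + d`, where
d is the degree of `q`. Bessel's inequality for kernels (`sum_sq_eval_le`) therefore bounds the
perturbed R̂_n pointwise by the unperturbed R_{n+d}, which also dominates R_n. The masses are n, n +
d and n, so R̂_n and R_n differ by at most 2d in L¹. The substitution in the rescaling preserves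
this distance and the factor 1/n sends it to zero, so only the unperturbed limit remains.

That limit is found by moments. By the three-term recurrence, `L (X ^ k * P m * P m)` is a diagonal
entry of the k-th power of a Jacobi matrix whose entries near m are ξ m^t beside the diagonal and ζ
m^t on it, up to o(m^t). Hence it is m^{kt} times the total weight of closed k-step walks, up to
o(m^{kt}) (`tendsto_apply_X_pow_mul`). Averaging over m < n produces the factor 1/(kt+1), and
dividing by D_n^{k/2} yields M^(k). These numbers grow at most geometrically in k, which is enough
for the method of moments (`weaklyConverges_of_moments`). -/

noncomputable section

namespace LevelDensity

/-! ### Orthonormal systems for a linear functional; the three-term recurrence -/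

/-- `P` is an orthonormal system of polynomials, one in each degree, for the linear functional
`L` on polynomials. -/
structure IsOrthonormalFor (L : ℝ[X] →ₗ[ℝ] ℝ) (P : ℕ → ℝ[X]) : Prop where
  degree_eq : ∀ n, (P n).degree = n
  orthonormal : ∀ m n, L (P m * P n) = if m = n then 1 else 0

namespace IsOrthonormalFor

variable {L : ℝ[X] →ₗ[ℝ] ℝ} {P : ℕ → ℝ[X]}

lemma natDegree_eq (h : IsOrthonormalFor L P) (n : ℕ) : (P n).natDegree = n :=
  natDegree_eq_of_degree_eq_some (h.degree_eq n)

lemma ne_zero (h : IsOrthonormalFor L P) (n : ℕ) : P n ≠ 0 := by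
  intro h0
  have := h.degree_eq n
  simp [h0] at this

lemma leadingCoeff_ne_zero (h : IsOrthonormalFor L P) (n : ℕ) : (P n).leadingCoeff ≠ 0 :=
  Polynomial.leadingCoeff_ne_zero.2 (h.ne_zero n)

lemma coeff_self (h : IsOrthonormalFor L P) (n : ℕ) :
    (P n).coeff n = (P n).leadingCoeff := by
  rw [leadingCoeff, h.natDegree_eq]

lemma coeff_of_lt (h : IsOrthonormalFor L P) {n m : ℕ} (hm : n < m) : (P n).coeff m = 0 :=
  coeff_eq_zero_of_natDegree_lt (by rwa [h.natDegree_eq])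

lemma exists_expansion (h : IsOrthonormalFor L P) (n : ℕ) :
    ∀ f : ℝ[X], f.degree < n → ∃ c : ℕ → ℝ, f = ∑ m ∈ Finset.range n, c m • P m := by
  induction n with
  | zero =>
    intro f hf
    refine ⟨0, ?_⟩
    simpa [Nat.WithBot.lt_zero_iff] using hf
  | succ n ih =>
    intro f hf
    obtain ⟨c, hc⟩ := ih (f - (f.coeff n / (P n).leadingCoeff) • P n) (by
      rw [degree_lt_iff_coeff_zero]
      intro m hm
      rcases hm.eq_or_lt with rfl | hm
      · rw [coeff_sub, coeff_smul, h.coeff_self, smul_eq_mul,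
          div_mul_cancel₀ _ (h.leadingCoeff_ne_zero _), sub_self]
      · rw [coeff_sub, coeff_smul, h.coeff_of_lt hm, smul_zero, sub_zero]
        exact (degree_lt_iff_coeff_zero f (n + 1)).1 hf m hm)
    refine ⟨Function.update c n (f.coeff n / (P n).leadingCoeff), ?_⟩
    rw [Finset.sum_range_succ, Function.update_self, Finset.sum_congr rfl
      (g := fun m => c m • P m), ← hc, sub_add_cancel]
    intro m hm
    rw [Function.update_of_ne (Finset.mem_range.1 hm).ne]

lemma apply_sum_smul_mul (h : IsOrthonormalFor L P) (c : ℕ → ℝ) (n m : ℕ) :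
    L ((∑ i ∈ Finset.range n, c i • P i) * P m) = if m < n then c m else 0 := by
  simp [Finset.sum_mul, map_sum, h.orthonormal]

lemma apply_mul_eq_zero (h : IsOrthonormalFor L P) {f : ℝ[X]} {n : ℕ} (hf : f.degree < n) :
    L (f * P n) = 0 := by
  obtain ⟨c, rfl⟩ := h.exists_expansion n f hf
  simp [h.apply_sum_smul_mul]

lemma expansion (h : IsOrthonormalFor L P) {f : ℝ[X]} {n : ℕ} (hf : f.degree < n) :
    f = ∑ m ∈ Finset.range n, L (f * P m) • P m := by
  obtain ⟨c, rfl⟩ := h.exists_expansion n f hf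
  refine Finset.sum_congr rfl fun m hm => ?_
  rw [h.apply_sum_smul_mul, if_pos (Finset.mem_range.1 hm)]

lemma apply_mul_self (h : IsOrthonormalFor L P) {f : ℝ[X]} {n : ℕ} (hf : f.degree < n) :
    L (f * f) = ∑ m ∈ Finset.range n, L (f * P m) ^ 2 := by
  conv_lhs => enter [2, 2]; rw [h.expansion hf]
  simp [Finset.mul_sum, map_sum, sq]

/-- Positivity of `L` is not assumed: Parseval's identity derives it from the existence of an
orthonormal system. -/
lemma apply_mul_self_nonneg (h : IsOrthonormalFor L P) (f : ℝ[X]) : 0 ≤ L (f * f) := by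
  rw [h.apply_mul_self (n := f.natDegree + 1)
    (degree_le_natDegree.trans_lt (by exact_mod_cast Nat.lt_succ_self _))]
  positivity

lemma apply_mul_self_pos (h : IsOrthonormalFor L P) {f : ℝ[X]} (hf : f ≠ 0) :
    0 < L (f * f) := by
  refine lt_of_le_of_ne (h.apply_mul_self_nonneg f) fun h0 => hf ?_
  have hd : f.degree < (f.natDegree + 1 : ℕ) :=
    degree_le_natDegree.trans_lt (by exact_mod_cast Nat.lt_succ_self _)
  rw [h.apply_mul_self hd, eq_comm, Finset.sum_eq_zero_iff_of_nonneg fun _ _ => sq_nonneg _] at h0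
  rw [h.expansion hd]
  exact Finset.sum_eq_zero fun m hm => by rw [pow_eq_zero_iff two_ne_zero |>.1 (h0 m hm), zero_smul]

/-- The reproducing property of the kernel of an orthonormal system. -/
lemma apply_mul_kernel (h : IsOrthonormalFor L P) {f : ℝ[X]} {n : ℕ} (hf : f.degree < n) (x : ℝ) :
    L (f * ∑ m ∈ Finset.range n, (P m).eval x • P m) = f.eval x := by
  conv_rhs => rw [h.expansion hf]
  simp [Finset.mul_sum, map_sum, eval_finsetSum, mul_comm]

/-- Bessel's inequality for kernels: an orthonormal family of polynomials of degree less than `N`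
has a smaller diagonal kernel than the full orthonormal system. -/
lemma sum_sq_eval_le (h : IsOrthonormalFor L P) {F : ℕ → ℝ[X]} {n N : ℕ}
    (hF : ∀ j < n, (F j).degree < N)
    (hortho : ∀ i j, L (F i * F j) = if i = j then 1 else 0) (x : ℝ) :
    ∑ j ∈ Finset.range n, (F j).eval x ^ 2 ≤ ∑ m ∈ Finset.range N, (P m).eval x ^ 2 := by
  set G : ℝ[X] := ∑ j ∈ Finset.range n, (F j).eval x • F j with hG
  set K : ℝ[X] := ∑ m ∈ Finset.range N, (P m).eval x • P m with hK
  have hGd : G.degree < N := by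
    rw [← mem_degreeLT]
    exact Submodule.sum_mem _ fun j hj => Submodule.smul_mem _ _
      (mem_degreeLT.2 (hF j (Finset.mem_range.1 hj)))
  have hGx : G.eval x = ∑ j ∈ Finset.range n, (F j).eval x ^ 2 := by
    simp [hG, eval_finsetSum, sq]
  have hGG : L (G * G) = ∑ j ∈ Finset.range n, (F j).eval x ^ 2 := by
    simp only [hG, Finset.sum_mul, Finset.mul_sum, map_sum, smul_mul_smul_comm, map_smul, hortho]
    simp +contextual [sq]
  have hKd : K.degree < N := by
    rw [← mem_degreeLT]
    refine Submodule.sum_mem _ fun j hj => Submodule.smul_mem _ _ (mem_degreeLT.2 ?_)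
    rw [h.degree_eq]
    exact_mod_cast Finset.mem_range.1 hj
  have hGK : L (G * K) = G.eval x := h.apply_mul_kernel hGd x
  have hKK : L (K * K) = K.eval x := h.apply_mul_kernel hKd x
  have hKx : K.eval x = ∑ m ∈ Finset.range N, (P m).eval x ^ 2 := by
    simp [hK, eval_finsetSum, sq]
  -- The pairings of K with G, K with K and G with G are G(x), K(x) and G(x), so positivity on `K -
  -- G` reads K(x) - G(x) ≥ 0.
  have := h.apply_mul_self_nonneg (K - G)
  have e : (K - G) * (K - G) = K * K - G * K - G * K + G * G := by ring
  rw [e, map_add, map_sub, map_sub, hGG, hGK, hKK, hKx, hGx] at this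
  linarith

lemma degree_X_mul_sub_lt (h : IsOrthonormalFor L P) (n : ℕ) :
    (X * P n - recAlpha P n • P (n + 1)).degree < ((n + 1 : ℕ) : WithBot ℕ) := by
  rw [degree_lt_iff_coeff_zero]
  intro m hm
  obtain ⟨m, rfl⟩ : ∃ k, m = k + 1 := ⟨m - 1, by omega⟩
  rw [coeff_sub, coeff_X_mul, coeff_smul, smul_eq_mul]
  rcases hm.eq_or_lt with e | hm
  · obtain rfl : n = m := by omega
    rw [h.coeff_self, h.coeff_self, recAlpha, div_mul_cancel₀ _ (h.leadingCoeff_ne_zero _), sub_self]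
  · rw [h.coeff_of_lt (by omega), h.coeff_of_lt (by omega)]
    simp

lemma nextCoeff_succ (h : IsOrthonormalFor L P) (n : ℕ) :
    (P (n + 1)).nextCoeff = (P (n + 1)).coeff n := by
  rw [nextCoeff_of_natDegree_pos (by rw [h.natDegree_eq]; omega), h.natDegree_eq,
    Nat.add_sub_cancel]

/-- `recAlpha` removes the leading term, and `recBeta` is exactly what removes the next one. -/
lemma degree_X_mul_sub_sub_lt (h : IsOrthonormalFor L P) (n : ℕ) :
    (X * P (n + 1) - recAlpha P (n + 1) • P (n + 2) - recBeta P (n + 1) • P (n + 1)).degree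
      < ((n + 1 : ℕ) : WithBot ℕ) := by
  rw [degree_lt_iff_coeff_zero]
  intro m hm
  rcases hm.eq_or_lt with rfl | hm
  · rw [coeff_sub, coeff_sub, coeff_X_mul, coeff_smul, coeff_smul, smul_eq_mul, smul_eq_mul,
      h.coeff_self, ← h.nextCoeff_succ n, ← h.nextCoeff_succ (n + 1), recAlpha, recBeta]
    have h1 := h.leadingCoeff_ne_zero (n + 1)
    have h2 := h.leadingCoeff_ne_zero (n + 2)
    field_simp
    ring
  · rw [coeff_sub, coeff_smul, h.coeff_of_lt hm, smul_zero, sub_zero]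
    exact (degree_lt_iff_coeff_zero _ _).1 (h.degree_X_mul_sub_lt (n + 1)) m hm

lemma apply_X_mul_succ (h : IsOrthonormalFor L P) (n : ℕ) :
    L (X * P n * P (n + 1)) = recAlpha P n := by
  have := h.apply_mul_eq_zero (h.degree_X_mul_sub_lt n)
  rw [sub_mul, map_sub, smul_mul_assoc, map_smul, h.orthonormal] at this
  simpa [sub_eq_zero] using this

/-- The three-term recurrence relation. -/
lemma X_mul (h : IsOrthonormalFor L P) (n : ℕ) :
    X * P (n + 1) = recAlpha P (n + 1) • P (n + 2) + recBeta P (n + 1) • P (n + 1)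
      + recAlpha P n • P n := by
  have hd : (X * P (n + 1) - recAlpha P (n + 1) • P (n + 2) - recBeta P (n + 1) • P (n + 1)
      - recAlpha P n • P n).degree < ((n + 1 : ℕ) : WithBot ℕ) := by
    rw [← mem_degreeLT]
    refine Submodule.sub_mem _ (mem_degreeLT.2 (h.degree_X_mul_sub_sub_lt n))
      (Submodule.smul_mem _ _ (mem_degreeLT.2 ?_))
    rw [h.degree_eq]
    exact_mod_cast Nat.lt_succ_self n
  have h0 := h.expansion hd
  rw [Finset.sum_eq_zero] at h0
  · rw [← sub_eq_zero, ← h0]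
    abel
  · intro m hm
    have hm := Finset.mem_range.1 hm
    simp only [sub_mul, map_sub, smul_mul_assoc, map_smul, h.orthonormal]
    rw [if_neg (by omega), if_neg (by omega)]
    -- Moving the factor X onto `P m` lowers the degree below `n + 1` when `m < n`; when `m = n` the
    -- pairing is `recAlpha P n`, cancelled by the third term.
    have e : X * P (n + 1) * P m = X * P m * P (n + 1) := by ring
    rcases (Nat.lt_succ_iff.1 hm).eq_or_lt with rfl | hm
    · simp [e, h.apply_X_mul_succ]
    · rw [e, h.apply_mul_eq_zero, if_neg (by omega)]
      · simp
      · rw [mul_comm, degree_mul_X, h.degree_eq]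
        exact_mod_cast (by omega : m + 1 < n + 1)

end IsOrthonormalFor

/-! ### Weighted walks and the numbers M^(k) -/

/-- The operator `f ↦ ξ f(· + 1) + ζ f + ξ f(· - 1)` on doubly infinite sequences. -/
def walkOp (ξ ζ : ℝ) : Module.End ℝ (ℤ → ℝ) :=
  ξ • (LinearMap.funLeft ℝ ℝ (fun j : ℤ => j + 1) + LinearMap.funLeft ℝ ℝ (fun j : ℤ => j - 1))
    + ζ • 1

/-- The total weight of the walks of `k` steps `-1, 0, 1` from `j` to `0`, where steps `±1` weigh
`ξ` and steps `0` weigh `ζ`. -/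
def walkWeight (ξ ζ : ℝ) (k : ℕ) : ℤ → ℝ :=
  (walkOp ξ ζ ^ k) (Pi.single 0 1)

lemma walkWeight_zero (ξ ζ : ℝ) (j : ℤ) : walkWeight ξ ζ 0 j = if j = 0 then 1 else 0 := by
  simp [walkWeight, Pi.single_apply]

lemma walkWeight_succ (ξ ζ : ℝ) (k : ℕ) (j : ℤ) :
    walkWeight ξ ζ (k + 1) j = ξ * walkWeight ξ ζ k (j + 1) + ζ * walkWeight ξ ζ k j
      + ξ * walkWeight ξ ζ k (j - 1) := by
  rw [walkWeight, pow_succ']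
  simp only [Module.End.mul_apply]
  rw [← walkWeight, walkOp]
  simp [LinearMap.funLeft_apply]
  ring

/-- The operator `walkOp` has sup-norm at most 2|ξ| + |ζ|. This is the source of the geometric bound
on the limiting moments. -/
lemma abs_walkWeight_le (ξ ζ : ℝ) (k : ℕ) :
    ∀ j, |walkWeight ξ ζ k j| ≤ (2 * |ξ| + |ζ|) ^ k := by
  induction k with
  | zero =>
    intro j
    rw [walkWeight_zero]
    split_ifs <;> simp
  | succ k ih =>
    intro j
    rw [walkWeight_succ]
    calc _ ≤ |ξ| * |walkWeight ξ ζ k (j + 1)| + |ζ| * |walkWeight ξ ζ k j|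
          + |ξ| * |walkWeight ξ ζ k (j - 1)| := by
          rw [← abs_mul, ← abs_mul, ← abs_mul]; exact abs_add_three _ _ _
      _ ≤ |ξ| * (2 * |ξ| + |ζ|) ^ k + |ζ| * (2 * |ξ| + |ζ|) ^ k
          + |ξ| * (2 * |ξ| + |ζ|) ^ k := by gcongr <;> exact ih _
      _ = (2 * |ξ| + |ζ|) ^ (k + 1) := by ring

lemma funLeft_add_pow (k : ℕ) (a : ℤ) :
    LinearMap.funLeft ℝ ℝ (fun j : ℤ => j + a) ^ k
      = LinearMap.funLeft ℝ ℝ (fun j : ℤ => j + k * a) := by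
  induction k with
  | zero => ext f j; simp [LinearMap.funLeft_apply]
  | succ k ih =>
    rw [pow_succ, ih]
    ext f j
    simp only [Module.End.mul_apply, LinearMap.funLeft_apply]
    congr 1
    push_cast
    ring

/-- The two shifts commute, so the binomial theorem applies; a walk of steps ±1 closes only when it
has equally many of each. -/
lemma shift_pow_apply (m : ℕ) :
    ((LinearMap.funLeft ℝ ℝ (fun j : ℤ => j + 1) + LinearMap.funLeft ℝ ℝ (fun j : ℤ => j - 1) :
      Module.End ℝ (ℤ → ℝ)) ^ m) (Pi.single 0 1) 0
      = if Even m then (m.choose (m / 2) : ℝ) else 0 := by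
  have hc : Commute (LinearMap.funLeft ℝ ℝ (fun j : ℤ => j + 1) : Module.End ℝ (ℤ → ℝ))
      (LinearMap.funLeft ℝ ℝ (fun j : ℤ => j - 1)) := by
    ext f j
    simp [Module.End.mul_apply, LinearMap.funLeft_apply]
  rw [hc.add_pow]
  simp only [sub_eq_add_neg, funLeft_add_pow]
  have key : ∀ i ∈ Finset.range (m + 1),
      ((LinearMap.funLeft ℝ ℝ (fun j : ℤ => j + i * 1) *
        LinearMap.funLeft ℝ ℝ (fun j : ℤ => j + (m - i : ℕ) * -1) *
          ((m.choose i : ℕ) : Module.End ℝ (ℤ → ℝ))) (Pi.single 0 1) 0 : ℝ)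
        = if m = 2 * i then (m.choose i : ℝ) else 0 := by
    intro i hi
    have hi := Finset.mem_range.1 hi
    have e : ((m.choose i : ℕ) : Module.End ℝ (ℤ → ℝ)) = (m.choose i : ℝ) • 1 := by
      ext; simp
    rw [e]
    simp only [Module.End.mul_apply, LinearMap.funLeft_apply, LinearMap.smul_apply,
      Module.End.one_apply, Pi.smul_apply, Pi.single_apply, smul_eq_mul]
    simp only [show (0 + (i : ℤ) * 1 + ((m - i : ℕ) : ℤ) * -1 = 0) ↔ m = 2 * i by omega]
    simp
  rw [LinearMap.sum_apply, Finset.sum_apply, Finset.sum_congr rfl key]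
  split_ifs with hm
  · obtain ⟨r, rfl⟩ := hm
    rw [Finset.sum_eq_single r]
    · rw [if_pos (by ring), show (r + r) / 2 = r by omega]
    · intro b _ hb
      rw [if_neg (by omega)]
    · intro h
      simp at h
  · refine Finset.sum_eq_zero fun i _ => if_neg ?_
    rintro rfl
    simp at hm

/-- The binomial theorem separates the ζ-steps from the `m` steps ±1, and only even `m = 2 * i`
contributes. -/
lemma walkWeight_apply_zero (ξ ζ : ℝ) (k : ℕ) :
    walkWeight ξ ζ k 0 = ∑ i ∈ Finset.range (k / 2 + 1),
      (k.choose i : ℝ) * ((k - i).choose i : ℝ) * ξ ^ (2 * i) * ζ ^ (k - 2 * i) := by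
  set S : Module.End ℝ (ℤ → ℝ) :=
    LinearMap.funLeft ℝ ℝ (fun j : ℤ => j + 1) + LinearMap.funLeft ℝ ℝ (fun j : ℤ => j - 1) with hS
  have hc : Commute (ξ • S) (ζ • (1 : Module.End ℝ (ℤ → ℝ))) :=
    ((Commute.one_right S).smul_left ξ).smul_right ζ
  have key : ∀ m ∈ Finset.range (k + 1),
      (((ξ • S) ^ m * (ζ • 1) ^ (k - m) * ((k.choose m : ℕ) : Module.End ℝ (ℤ → ℝ)))
        (Pi.single 0 1) 0 : ℝ)
      = if Even m then (k.choose m : ℝ) * (m.choose (m / 2) : ℝ) * ξ ^ m * ζ ^ (k - m) else 0 := by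
    intro m _
    have e : ((k.choose m : ℕ) : Module.End ℝ (ℤ → ℝ)) = (k.choose m : ℝ) • 1 := by
      ext; simp
    have e2 : (ξ • S) ^ m * (ζ • 1) ^ (k - m) * ((k.choose m : ℕ) : Module.End ℝ (ℤ → ℝ))
        = (ξ ^ m * ζ ^ (k - m) * (k.choose m : ℝ)) • S ^ m := by
      rw [e, _root_.smul_pow, _root_.smul_pow, one_pow, smul_mul_smul_comm, smul_mul_smul_comm, mul_one, mul_one]
    rw [e2, LinearMap.smul_apply, Pi.smul_apply, hS, shift_pow_apply]
    split_ifs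
    · rw [smul_eq_mul]; ring
    · simp
  rw [walkWeight, walkOp, ← hS, hc.add_pow, LinearMap.sum_apply, Finset.sum_apply,
    Finset.sum_congr rfl key, ← Finset.sum_filter]
  symm
  refine Finset.sum_bij (fun i _ => 2 * i) ?_ ?_ ?_ ?_
  · intro i hi
    simp only [Finset.mem_range, Finset.mem_filter] at hi ⊢
    exact ⟨by omega, even_two_mul i⟩
  · intro a _ b _ hab
    omega
  · intro b hb
    simp only [Finset.mem_range, Finset.mem_filter] at hb
    obtain ⟨r, rfl⟩ := hb.2
    exact ⟨r, by simp; omega, by ring⟩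
  · intro i hi
    have hi := Finset.mem_range.1 hi
    -- C(k,2i) C(2i,i) = C(k,i) C(k-i,i): choosing the places of all ±1 steps and then the up-steps,
    -- or the up-steps and then the down-steps.
    have h := Nat.choose_mul (n := k) (k := 2 * i) (s := i) (by omega)
    rw [show 2 * i - i = i by omega] at h
    have h' : (k.choose (2 * i) : ℝ) * ((2 * i).choose i : ℝ)
        = (k.choose i : ℝ) * ((k - i).choose i : ℝ) := by exact_mod_cast h
    rw [show 2 * i / 2 = i by omega, h']

lemma abs_levelMoment_le {ξ ζ t : ℝ} (ht : 0 ≤ t) (k : ℕ) :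
    |levelMoment ξ ζ t k|
      ≤ ((2 * |ξ| + |ζ|) / √(2 * ξ ^ 2 + ζ ^ 2) * √(2 * t + 1)) ^ k := by
  have hk : ∀ a : ℝ, 0 ≤ a → a ^ ((k : ℝ) / 2) = √a ^ k := fun a ha => by
    rw [Real.sqrt_eq_rpow, ← Real.rpow_natCast, ← Real.rpow_mul ha]
    congr 1
    ring
  rw [levelMoment, ← walkWeight_apply_zero, hk _ (by positivity), hk _ (by positivity), abs_mul,
    abs_div, abs_div, mul_pow, div_pow, abs_of_nonneg (a := √_ ^ k) (by positivity),
    abs_of_nonneg (a := √_ ^ k) (by positivity)]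
  have h1 : (1 : ℝ) ≤ |(k : ℝ) * t + 1| := by
    rw [abs_of_nonneg (by positivity)]
    have : 0 ≤ (k : ℝ) * t := by positivity
    linarith
  gcongr
  · exact abs_walkWeight_le ξ ζ k 0
  · exact div_le_self (by positivity) h1

/-! ### Polynomial approximation and the method of moments -/

lemma integrable_eval_mul {w : ℝ → ℝ} (hw : ∀ k : ℕ, Integrable (fun x => x ^ k * w x))
    (p : ℝ[X]) : Integrable (fun x => p.eval x * w x) := by
  simp only [eval_eq_sum_range, Finset.sum_mul, mul_assoc]
  exact integrable_finsetSum _ fun i _ => (hw i).const_mul _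

/-- The linear functional `p ↦ ∫ p w` on polynomials. -/
def momentFunctional (w : ℝ → ℝ) (hw : ∀ k : ℕ, Integrable (fun x => x ^ k * w x)) :
    ℝ[X] →ₗ[ℝ] ℝ where
  toFun p := ∫ x, p.eval x * w x
  map_add' p r := by
    simp only [eval_add, add_mul]
    exact integral_add (integrable_eval_mul hw p) (integrable_eval_mul hw r)
  map_smul' c p := by
    simp only [eval_smul, smul_eq_mul, mul_assoc, RingHom.id_apply]
    exact integral_const_mul _ _

lemma momentFunctional_apply {w : ℝ → ℝ} (hw : ∀ k : ℕ, Integrable (fun x => x ^ k * w x))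
    (p : ℝ[X]) : momentFunctional w hw p = ∫ x, p.eval x * w x := rfl

/-- A continuous bounded function differs from some polynomial by at most another polynomial with
small integral, provided that the moments of the density grow at most geometrically. -/
lemma exists_polynomial_approx {σ : ℝ → ℝ} (hσ : ∀ k : ℕ, Integrable (fun x => x ^ k * σ x))
    {C : ℝ} (hC : ∀ k : ℕ, |∫ x, x ^ k * σ x| ≤ C ^ k) (φ : ℝ →ᵇ ℝ) {ε : ℝ} (hε : 0 < ε) :
    ∃ p r : ℝ[X], (∀ x, |φ x - p.eval x| ≤ r.eval x) ∧ ∫ x, r.eval x * σ x < ε := by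
  have hC0 : 0 ≤ C := by simpa using (abs_nonneg _).trans (hC 1)
  -- Weierstrass approximation is used on an interval whose radius exceeds the moment growth rate
  -- `C`, so that (C/A)^(2j) tends to zero below.
  set A : ℝ := C + 1 with hA
  have hA1 : 1 ≤ A := by linarith
  obtain ⟨p, hp⟩ := exists_polynomial_near_of_continuousOn (-A) A φ φ.continuous.continuousOn
    (ε / 4) (by positivity)
  set N := p.natDegree
  set K : ℝ := ‖φ‖ + ∑ i ∈ Finset.range (N + 1), |p.coeff i| with hK
  have hK0 : 0 ≤ K := by positivity
  have hbound : ∀ x : ℝ, 1 ≤ |x| → |φ x - p.eval x| ≤ K * x ^ (2 * N) := by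
    intro x hx
    have hx2 : x ^ (2 * N) = |x| ^ (2 * N) := by rw [pow_mul, pow_mul, sq_abs]
    have h1 : |φ x| ≤ ‖φ‖ * |x| ^ (2 * N) :=
      (φ.norm_coe_le_norm x).trans (le_mul_of_one_le_right (norm_nonneg _) (one_le_pow₀ hx))
    have h2 : |p.eval x| ≤ (∑ i ∈ Finset.range (N + 1), |p.coeff i|) * |x| ^ (2 * N) := by
      rw [eval_eq_sum_range, Finset.sum_mul]
      refine (Finset.abs_sum_le_sum_abs _ _).trans (Finset.sum_le_sum fun i hi => ?_)
      rw [abs_mul, abs_pow]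
      have := Finset.mem_range.1 hi
      exact mul_le_mul_of_nonneg_left (pow_le_pow_right₀ hx (by omega)) (abs_nonneg _)
    rw [hx2, hK, add_mul]
    exact (abs_sub _ _).trans (add_le_add h1 h2)
  have hlim : Tendsto (fun j : ℕ => K * C ^ (2 * N) * ((C / A) ^ 2) ^ j) atTop (𝓝 0) := by
    have hCA : C / A < 1 := by rw [div_lt_one (by positivity)]; linarith
    have : (C / A) ^ 2 < 1 := pow_lt_one₀ (by positivity) hCA two_ne_zero
    simpa using (tendsto_pow_atTop_nhds_zero_of_lt_one (by positivity) this).const_mul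
      (K * C ^ (2 * N))
  obtain ⟨j, hj⟩ := (hlim.eventually (gt_mem_nhds (show 0 < ε / 4 by positivity))).exists
  -- The constant covers |x| ≤ A. Beyond, (x/A)^(2j) ≥ 1 lets the second term dominate K x^(2N),
  -- while its integral is at most K C^(2N) (C/A)^(2j), small by the choice of `j`. Even exponents
  -- keep it nonnegative everywhere.
  refine ⟨p, Polynomial.C (ε / 4) + (K / A ^ (2 * j)) • X ^ (2 * N + 2 * j), fun x => ?_, ?_⟩
  · simp only [eval_add, eval_C, eval_smul, eval_pow, eval_X, smul_eq_mul]
    have hnn : 0 ≤ K / A ^ (2 * j) * x ^ (2 * N + 2 * j) := by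
      rw [← mul_add, pow_mul x]
      positivity
    rcases le_or_gt |x| A with hx | hx
    · rw [abs_sub_comm]
      linarith [(hp x (abs_le.1 hx)).le]
    · have h1 := hbound x (hA1.trans hx.le)
      have h2 : 1 ≤ x ^ (2 * j) / A ^ (2 * j) := by
        rw [one_le_div (by positivity), pow_mul x, ← sq_abs, ← pow_mul]
        exact pow_le_pow_left₀ (by positivity) hx.le _
      have h3 : K * x ^ (2 * N) ≤ K * x ^ (2 * N) * (x ^ (2 * j) / A ^ (2 * j)) :=
        le_mul_of_one_le_right ((abs_nonneg _).trans h1) h2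
      have h4 : K * x ^ (2 * N) * (x ^ (2 * j) / A ^ (2 * j))
          = K / A ^ (2 * j) * x ^ (2 * N + 2 * j) := by rw [pow_add]; ring
      linarith
  · rw [← momentFunctional_apply hσ, map_add, map_smul, ← mul_one (Polynomial.C (ε / 4)),
      ← smul_eq_C_mul, map_smul, ← pow_zero X]
    simp only [momentFunctional_apply, eval_pow, eval_X, smul_eq_mul]
    have h0 := (le_abs_self _).trans (hC 0)
    have h1 := (le_abs_self _).trans (hC (2 * N + 2 * j))
    have h2 : K / A ^ (2 * j) * ∫ x, x ^ (2 * N + 2 * j) * σ x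
        ≤ K / A ^ (2 * j) * C ^ (2 * N + 2 * j) := by gcongr
    have h3 : K / A ^ (2 * j) * C ^ (2 * N + 2 * j) = K * C ^ (2 * N) * ((C / A) ^ 2) ^ j := by
      rw [pow_add, ← pow_mul, div_pow]; ring
    have h4 : ε / 4 * ∫ x, x ^ 0 * σ x ≤ ε / 4 * C ^ 0 := by gcongr
    rw [pow_zero, mul_one] at h4
    linarith

lemma integrable_bounded_mul {f : ℝ → ℝ} (hf : Integrable f) (φ : ℝ →ᵇ ℝ) :
    Integrable (fun x => φ x * f x) :=
  hf.bdd_mul φ.continuous.aestronglyMeasurable (Eventually.of_forall φ.norm_coe_le_norm)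

lemma abs_integral_sub_le {f : ℝ → ℝ} (hf0 : ∀ x, 0 ≤ f x)
    (hf : ∀ k : ℕ, Integrable (fun x => x ^ k * f x)) (φ : ℝ →ᵇ ℝ) {p r : ℝ[X]}
    (h : ∀ x, |φ x - p.eval x| ≤ r.eval x) :
    |(∫ x, φ x * f x) - ∫ x, p.eval x * f x| ≤ ∫ x, r.eval x * f x := by
  have hf1 : Integrable f := by simpa using hf 0
  rw [← integral_sub (integrable_bounded_mul hf1 φ) (integrable_eval_mul hf p)]
  refine (abs_integral_le_integral_abs).trans (integral_mono_of_nonneg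
    (Eventually.of_forall fun _ => abs_nonneg _) (integrable_eval_mul hf r)
    (Eventually.of_forall fun x => ?_))
  simp only
  rw [← sub_mul, abs_mul, abs_of_nonneg (hf0 x)]
  exact mul_le_mul_of_nonneg_right (h x) (hf0 x)

lemma tendsto_integral_eval_mul {f : ℕ → ℝ → ℝ} {σ : ℝ → ℝ}
    (hf : ∀ n k, Integrable (fun x => x ^ k * f n x))
    (hσ : ∀ k : ℕ, Integrable (fun x => x ^ k * σ x))
    (hlim : ∀ k : ℕ, Tendsto (fun n => ∫ x, x ^ k * f n x) atTop (𝓝 (∫ x, x ^ k * σ x)))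
    (p : ℝ[X]) :
    Tendsto (fun n => ∫ x, p.eval x * f n x) atTop (𝓝 (∫ x, p.eval x * σ x)) := by
  simp only [eval_eq_sum_range, Finset.sum_mul, mul_assoc]
  rw [integral_finsetSum _ fun i _ => (hσ i).const_mul _]
  simp_rw [integral_finsetSum _ fun i _ => (hf _ i).const_mul _, integral_const_mul]
  exact tendsto_finsetSum _ fun i _ => (hlim i).const_mul _

/-- The method of moments, for limits whose moments grow at most geometrically. -/
lemma weaklyConverges_of_moments {f : ℕ → ℝ → ℝ} {σ : ℝ → ℝ} (hf0 : ∀ n x, 0 ≤ f n x)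
    (hf : ∀ n k, Integrable (fun x => x ^ k * f n x)) (hσ0 : ∀ x, 0 ≤ σ x)
    (hσ : ∀ k : ℕ, Integrable (fun x => x ^ k * σ x))
    {C : ℝ} (hC : ∀ k : ℕ, |∫ x, x ^ k * σ x| ≤ C ^ k)
    (hlim : ∀ k : ℕ, Tendsto (fun n => ∫ x, x ^ k * f n x) atTop (𝓝 (∫ x, x ^ k * σ x))) :
    WeaklyConverges f σ := by
  intro φ
  rw [Metric.tendsto_nhds]
  intro ε hε
  -- Since `r` is a polynomial, convergence of moments also makes its integral against `f n`
  -- eventually small; no separate tightness argument is needed.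
  obtain ⟨p, r, hpr, hr⟩ := exists_polynomial_approx hσ hC φ (show 0 < ε / 4 by positivity)
  have hp := tendsto_integral_eval_mul hf hσ hlim p
  have hr' := tendsto_integral_eval_mul hf hσ hlim r
  filter_upwards [hr'.eventually (gt_mem_nhds hr),
    Metric.tendsto_nhds.1 hp (ε / 4) (by positivity)] with n h1 h2
  have h3 := abs_integral_sub_le (hf0 n) (hf n) φ hpr
  have h4 := abs_integral_sub_le hσ0 hσ φ hpr
  rw [Real.dist_eq] at h2 ⊢
  rw [abs_le] at h3 h4
  rw [abs_lt] at h2 ⊢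
  constructor <;> linarith

/-! ### Power sums and index shifts -/

lemma tendsto_sum_rpow {s : ℝ} (hs : 0 ≤ s) :
    Tendsto (fun n : ℕ => (∑ m ∈ Finset.range n, (m : ℝ) ^ s) / (n : ℝ) ^ (s + 1)) atTop
      (𝓝 (1 / (s + 1))) := by
  have hmono : ∀ n : ℕ, MonotoneOn (fun x : ℝ => x ^ s) (Set.Icc ((0 : ℕ) : ℝ) (n : ℕ)) :=
    fun n x hx y _ hxy => Real.rpow_le_rpow (by simpa using hx.1) hxy hs
  have hint : ∀ n : ℕ, ∫ x in ((0 : ℕ) : ℝ)..(n : ℕ), x ^ s = (n : ℝ) ^ (s + 1) / (s + 1) := by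
    intro n
    rw [integral_rpow (Or.inl (by linarith)), Nat.cast_zero, Real.zero_rpow (by linarith), sub_zero]
  have hpos : ∀ n : ℕ, 1 ≤ n → 0 < (n : ℝ) ^ (s + 1) := fun n hn =>
    Real.rpow_pos_of_pos (by exact_mod_cast hn) _
  have hupper : ∀ n : ℕ, ∑ m ∈ Finset.range n, (m : ℝ) ^ s ≤ (n : ℝ) ^ (s + 1) / (s + 1) := by
    intro n
    have := (hmono n).sum_le_integral_Ico (Nat.zero_le n)
    rwa [hint, ← Finset.range_eq_Ico] at this
  have hlower : ∀ n : ℕ, (n : ℝ) ^ (s + 1) / (s + 1) - (n : ℝ) ^ s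
      ≤ ∑ m ∈ Finset.range n, (m : ℝ) ^ s := by
    intro n
    have h := (hmono n).integral_le_sum_Ico (Nat.zero_le n)
    rw [hint, ← Finset.range_eq_Ico] at h
    have e1 := Finset.sum_range_succ (fun m : ℕ => (m : ℝ) ^ s) n
    -- The integral is bounded by the sum of (m+1)^s, which exceeds the sum of m^s by n^s - 0^s; for
    -- s = 0 the last term is 1, so only its sign is used.
    have e2 := Finset.sum_range_succ' (fun m : ℕ => (m : ℝ) ^ s) n
    have h0 : 0 ≤ ((0 : ℕ) : ℝ) ^ s := by positivity
    linarith
  have hinv : Tendsto (fun n : ℕ => 1 / (s + 1) - 1 / (n : ℝ)) atTop (𝓝 (1 / (s + 1))) := by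
    simpa using (tendsto_const_nhds (x := 1 / (s + 1))).sub
      (tendsto_one_div_atTop_nhds_zero_nat (𝕜 := ℝ))
  refine tendsto_of_tendsto_of_tendsto_of_le_of_le' hinv tendsto_const_nhds ?_ ?_
  · filter_upwards [eventually_ge_atTop 1] with n hn
    rw [le_div_iff₀ (hpos n hn)]
    refine le_trans (le_of_eq ?_) (hlower n)
    have : (n : ℝ) ≠ 0 := by positivity
    rw [Real.rpow_add_one this]
    field_simp
  · filter_upwards [eventually_ge_atTop 1] with n hn
    rw [div_le_iff₀ (hpos n hn)]
    exact (hupper n).trans (le_of_eq (by ring))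

/-- Power-weighted Cesàro means. -/
lemma tendsto_sum_of_tendsto_div_rpow {s c : ℝ} (hs : 0 ≤ s) {μ : ℕ → ℝ}
    (hμ : Tendsto (fun m : ℕ => μ m / (m : ℝ) ^ s) atTop (𝓝 c)) :
    Tendsto (fun n : ℕ => (1 / (n : ℝ) * ∑ m ∈ Finset.range n, μ m) / (n : ℝ) ^ s) atTop
      (𝓝 (c / (s + 1))) := by
  have hsum := tendsto_sum_rpow hs
  have hatTop : Tendsto (fun n : ℕ => ∑ m ∈ Finset.range n, (m : ℝ) ^ s) atTop atTop := by
    have h1 : Tendsto (fun n : ℕ => (n : ℝ) ^ (s + 1)) atTop atTop :=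
      (tendsto_rpow_atTop (by linarith)).comp tendsto_natCast_atTop_atTop
    refine (hsum.pos_mul_atTop (by positivity) h1).congr' ?_
    filter_upwards [eventually_ge_atTop 1] with n hn
    have : 0 < (n : ℝ) ^ (s + 1) := Real.rpow_pos_of_pos (by exact_mod_cast hn) _
    exact div_mul_cancel₀ _ this.ne'
  have hlo : (fun m : ℕ => μ m - c * (m : ℝ) ^ s) =o[atTop] fun m : ℕ => (m : ℝ) ^ s := by
    rw [Asymptotics.isLittleO_iff_tendsto']
    · have := hμ.sub_const c
      rw [sub_self] at this
      refine this.congr' ?_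
      filter_upwards [eventually_ge_atTop 1] with n hn
      have : 0 < (n : ℝ) ^ s := Real.rpow_pos_of_pos (by exact_mod_cast hn) _
      field_simp
    · filter_upwards [eventually_ge_atTop 1] with n hn h0
      have : 0 < (n : ℝ) ^ s := Real.rpow_pos_of_pos (by exact_mod_cast hn) _
      exact absurd h0 this.ne'
  -- A sum of o(m^s) terms is o of the sum of m^s, because the latter diverges.
  have hlo' := (hlo.sum_range (fun n => by positivity) hatTop).tendsto_div_nhds_zero
  have := (hlo'.mul hsum).add (hsum.const_mul c)
  rw [zero_mul, zero_add, mul_one_div] at this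
  refine this.congr' ?_
  filter_upwards [eventually_ge_atTop 1, hatTop.eventually_gt_atTop 0] with n hn hS
  have h0 : (n : ℝ) ≠ 0 := by positivity
  have : 0 < (n : ℝ) ^ s := Real.rpow_pos_of_pos (by exact_mod_cast hn) _
  rw [Finset.sum_sub_distrib, ← Finset.mul_sum, Real.rpow_add_one h0]
  field_simp
  ring

lemma tendsto_toNat_add (j : ℤ) : Tendsto (fun m : ℕ => ((m : ℤ) + j).toNat) atTop atTop := by
  refine tendsto_atTop.2 fun b => ?_
  filter_upwards [eventually_ge_atTop (b + j.natAbs)] with m hm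
  omega

/-- (m+j)^t / m^t tends to 1, and truncation by `toNat` affects only finitely many m. -/
lemma tendsto_shift_div_rpow {a : ℕ → ℝ} {t c : ℝ}
    (ha : Tendsto (fun n : ℕ => a n / (n : ℝ) ^ t) atTop (𝓝 c)) (j : ℤ) :
    Tendsto (fun m : ℕ => a ((m : ℤ) + j).toNat / (m : ℝ) ^ t) atTop (𝓝 c) := by
  have h1 := ha.comp (tendsto_toNat_add j)
  have h2 : Tendsto (fun m : ℕ => ((((m : ℤ) + j).toNat : ℕ) : ℝ) / (m : ℝ)) atTop (𝓝 1) := by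
    have h3 : Tendsto (fun m : ℕ => 1 + (j : ℝ) * (1 / (m : ℝ))) atTop (𝓝 1) := by
      simpa using ((tendsto_one_div_atTop_nhds_zero_nat (𝕜 := ℝ)).const_mul (j : ℝ)).const_add 1
    refine h3.congr' ?_
    filter_upwards [eventually_ge_atTop (1 + j.natAbs)] with m hm
    have h4 : ((((m : ℤ) + j).toNat : ℕ) : ℝ) = (m : ℝ) + j := by
      have : ((((m : ℤ) + j).toNat : ℕ) : ℤ) = (m : ℤ) + j := Int.toNat_of_nonneg (by omega)
      exact_mod_cast this
    have : (m : ℝ) ≠ 0 := by exact_mod_cast (by omega : m ≠ 0)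
    rw [h4]
    field_simp
  have h5 := h1.mul (h2.rpow_const (p := t) (Or.inl one_ne_zero))
  rw [Real.one_rpow, mul_one] at h5
  refine h5.congr' ?_
  filter_upwards [eventually_ge_atTop (1 + j.natAbs)] with m hm
  have h6 : 0 < ((((m : ℤ) + j).toNat : ℕ) : ℝ) ^ t :=
    Real.rpow_pos_of_pos (by exact_mod_cast (by omega : 0 < ((m : ℤ) + j).toNat)) _
  simp only [Function.comp_apply]
  rw [Real.div_rpow (by positivity) (by positivity)]
  field_simp

/-! ### Asymptotics of powers of the Jacobi matrix -/

namespace IsOrthonormalFor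

variable {L : ℝ[X] →ₗ[ℝ] ℝ} {P : ℕ → ℝ[X]}

/-- Expanding only the last factor reproduces the recursion `walkWeight_succ`, with coefficients
depending on the site. -/
lemma apply_X_pow_succ_mul (h : IsOrthonormalFor L P) (k m i : ℕ) :
    L (X ^ (k + 1) * P m * P (i + 1)) = recAlpha P (i + 1) * L (X ^ k * P m * P (i + 2))
      + recBeta P (i + 1) * L (X ^ k * P m * P (i + 1))
      + recAlpha P i * L (X ^ k * P m * P i) := by
  have e : X ^ (k + 1) * P m * P (i + 1) = X ^ k * P m * (X * P (i + 1)) := by ring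
  simp only [e, h.X_mul, mul_add, mul_smul_comm, map_add, map_smul, smul_eq_mul]

/-- Asymptotics of the matrix elements of the powers of the Jacobi matrix. -/
lemma tendsto_apply_X_pow_mul (h : IsOrthonormalFor L P) {ξ ζ t : ℝ}
    (hα : Tendsto (fun n : ℕ => recAlpha P n / (n : ℝ) ^ t) atTop (𝓝 ξ))
    (hβ : Tendsto (fun n : ℕ => recBeta P n / (n : ℝ) ^ t) atTop (𝓝 ζ)) (k : ℕ) :
    ∀ j : ℤ, Tendsto (fun m : ℕ => L (X ^ k * P m * P ((m : ℤ) + j).toNat)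
      / (m : ℝ) ^ ((k : ℝ) * t)) atTop (𝓝 (walkWeight ξ ζ k j)) := by
  induction k with
  | zero =>
    intro j
    refine tendsto_const_nhds.congr' ?_
    filter_upwards [eventually_ge_atTop (1 + j.natAbs)] with m hm
    rw [walkWeight_zero, pow_zero, one_mul, h.orthonormal, Nat.cast_zero, zero_mul,
      Real.rpow_zero, div_one]
    congr 1
    exact propext ⟨fun _ => by omega, fun _ => by omega⟩
  | succ k ih =>
    intro j
    rw [walkWeight_succ]
    have h1 := (tendsto_shift_div_rpow hα j).mul (ih (j + 1))
    have h2 := (tendsto_shift_div_rpow hβ j).mul (ih j)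
    have h3 := (tendsto_shift_div_rpow hα (j - 1)).mul (ih (j - 1))
    refine ((h1.add h2).add h3).congr' ?_
    filter_upwards [eventually_ge_atTop (1 + j.natAbs)] with m hm
    obtain ⟨i, hi⟩ : ∃ i : ℕ, (m : ℤ) + j = i + 1 := ⟨((m : ℤ) + j - 1).toNat, by omega⟩
    rw [show ((m : ℤ) + j).toNat = i + 1 by omega, show ((m : ℤ) + (j + 1)).toNat = i + 2 by omega,
      show ((m : ℤ) + (j - 1)).toNat = i by omega, h.apply_X_pow_succ_mul]
    have hm0 : 0 < (m : ℝ) := by exact_mod_cast (by omega : 0 < m)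
    have e : (m : ℝ) ^ (((k + 1 : ℕ) : ℝ) * t) = (m : ℝ) ^ ((k : ℝ) * t) * (m : ℝ) ^ t := by
      rw [← Real.rpow_add hm0]
      congr 1
      push_cast
      ring
    have p1 := (Real.rpow_pos_of_pos hm0 t).ne'
    have p2 := (Real.rpow_pos_of_pos hm0 ((k : ℝ) * t)).ne'
    rw [e]
    field_simp

end IsOrthonormalFor

lemma ExpGrowth.tendsto_div_rpow {ξ ζ t : ℝ} {α β : ℕ → ℝ} (h : ExpGrowth ξ ζ t α β) :
    Tendsto (fun n : ℕ => α n / (n : ℝ) ^ t) atTop (𝓝 ξ) ∧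
      Tendsto (fun n : ℕ => β n / (n : ℝ) ^ t) atTop (𝓝 ζ) := by
  obtain ⟨-, -, ht, -, ξ', ζ', η', hξ', hζ', hη', heq⟩ := h
  have hη : Tendsto (fun n : ℕ => η' n / (n : ℝ) ^ t) atTop (𝓝 0) := by
    refine squeeze_zero_norm' ?_ (tendsto_zero_iff_norm_tendsto_zero.1 hη')
    filter_upwards [eventually_ge_atTop 1] with n hn
    have h1 : 1 ≤ (n : ℝ) ^ t := Real.one_le_rpow (by exact_mod_cast hn) ht
    rw [norm_div, Real.norm_of_nonneg (by positivity : 0 ≤ (n : ℝ) ^ t)]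
    exact div_le_self (norm_nonneg _) h1
  constructor
  · have := (hξ'.const_add 1).const_mul ξ
    rw [add_zero, mul_one] at this
    refine this.congr' ?_
    filter_upwards [eventually_ge_atTop 1] with n hn
    have : 0 < (n : ℝ) ^ t := Real.rpow_pos_of_pos (by exact_mod_cast hn) _
    rw [(heq n hn).1]
    field_simp
  · have := ((hζ'.const_add 1).const_mul ζ).add hη
    rw [add_zero, add_zero, mul_one] at this
    refine this.congr' ?_
    filter_upwards [eventually_ge_atTop 1] with n hn
    have : 0 < (n : ℝ) ^ t := Real.rpow_pos_of_pos (by exact_mod_cast hn) _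
    rw [(heq n hn).2]
    field_simp

/-! ### Rescaled level densities and the unperturbed limit -/

/-- The density `x ↦ (s / n) g(x s)`. -/
def rescale (s : ℝ) (n : ℕ) (g : ℝ → ℝ) (x : ℝ) : ℝ :=
  s / (n : ℝ) * g (x * s)

lemma integral_mul_rescale {s : ℝ} (hs : 0 < s) (n : ℕ) (f g : ℝ → ℝ) :
    ∫ x, f x * rescale s n g x = 1 / (n : ℝ) * ∫ y, f (y / s) * g y := by
  have h := Measure.integral_comp_mul_right (fun y => f (y / s) * g y) s
  rw [abs_of_pos (inv_pos.2 hs), smul_eq_mul] at h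
  have e : ∀ x, f x * rescale s n g x = s / (n : ℝ) * (f (x * s / s) * g (x * s)) := by
    intro x
    rw [rescale, mul_div_cancel_right₀ _ hs.ne']
    ring
  simp_rw [e]
  rw [integral_const_mul, h]
  field_simp

lemma integrable_mul_rescale {s : ℝ} (hs : 0 < s) (n : ℕ) {f g : ℝ → ℝ}
    (h : Integrable fun y => f (y / s) * g y) : Integrable fun x => f x * rescale s n g x := by
  refine ((h.comp_mul_right' hs.ne').const_mul (s / (n : ℝ))).congr (Eventually.of_forall fun x => ?_)
  simp only [rescale]
  rw [mul_div_cancel_right₀ _ hs.ne']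
  ring

lemma IsNormalizedWeight.perturbedWeight_integrable_pow {w : ℝ → ℝ} (hw : IsNormalizedWeight w)
    (q : ℝ[X]) (k : ℕ) : Integrable (fun x => x ^ k * perturbedWeight w q x) := by
  refine (integrable_eval_mul hw.integrable_pow (X ^ k * q ^ 2)).congr
    (Eventually.of_forall fun x => ?_)
  simp [perturbedWeight, mul_assoc]

lemma IsOrthonormalPolys.isOrthonormalFor {w : ℝ → ℝ} {P : ℕ → ℝ[X]}
    (hP : IsOrthonormalPolys w P) (hw : ∀ k : ℕ, Integrable (fun x => x ^ k * w x)) :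
    IsOrthonormalFor (momentFunctional w hw) P where
  degree_eq := hP.degree_eq
  orthonormal m n := by
    simpa only [momentFunctional_apply, eval_mul] using hP.orthonormal m n

section OneLevel

variable {w : ℝ → ℝ} {P : ℕ → ℝ[X]}

lemma oneLevel_eq (w : ℝ → ℝ) (P : ℕ → ℝ[X]) (n : ℕ) (x : ℝ) :
    oneLevel w P n x = (∑ m ∈ Finset.range n, P m * P m).eval x * w x := by
  simp [oneLevel, eval_finsetSum, Finset.sum_mul, sq]

lemma oneLevel_nonneg (hw : ∀ x, 0 ≤ w x) (n : ℕ) (x : ℝ) : 0 ≤ oneLevel w P n x :=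
  Finset.sum_nonneg fun _ _ => mul_nonneg (sq_nonneg _) (hw x)

lemma integrable_pow_mul_oneLevel (hw : ∀ k : ℕ, Integrable (fun x => x ^ k * w x)) (n k : ℕ) :
    Integrable (fun x => x ^ k * oneLevel w P n x) := by
  refine (integrable_eval_mul hw (X ^ k * ∑ m ∈ Finset.range n, P m * P m)).congr
    (Eventually.of_forall fun x => ?_)
  simp only [oneLevel_eq, eval_mul, eval_pow, eval_X, mul_assoc]

lemma integrable_oneLevel (hw : ∀ k : ℕ, Integrable (fun x => x ^ k * w x)) (n : ℕ) :
    Integrable (oneLevel w P n) := by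
  simpa using integrable_pow_mul_oneLevel (P := P) hw n 0

lemma integral_pow_mul_oneLevel (hw : ∀ k : ℕ, Integrable (fun x => x ^ k * w x)) (n k : ℕ) :
    ∫ x, x ^ k * oneLevel w P n x
      = ∑ m ∈ Finset.range n, momentFunctional w hw (X ^ k * P m * P m) := by
  simp only [mul_assoc, ← map_sum, ← Finset.mul_sum]
  rw [momentFunctional_apply]
  simp only [oneLevel_eq, eval_mul, eval_pow, eval_X, mul_assoc]

lemma integral_oneLevel (hP : IsOrthonormalPolys w P)
    (hw : ∀ k : ℕ, Integrable (fun x => x ^ k * w x)) (n : ℕ) :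
    ∫ x, oneLevel w P n x = n := by
  have h := integral_pow_mul_oneLevel (P := P) hw n 0
  simpa [(hP.isOrthonormalFor hw).orthonormal] using h

lemma secondMoment_eq (hw : ∀ k : ℕ, Integrable (fun x => x ^ k * w x)) (n : ℕ) :
    secondMoment w P n
      = 1 / (n : ℝ) * ∑ m ∈ Finset.range n, momentFunctional w hw (X ^ 2 * P m * P m) := by
  rw [secondMoment, ← integral_pow_mul_oneLevel hw, ← integral_const_mul]
  congr 1
  ext x
  ring

/-- D_n averages the squared norms of the nonzero polynomials `X * P m`. -/
lemma secondMoment_pos (hP : IsOrthonormalPolys w P)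
    (hw : ∀ k : ℕ, Integrable (fun x => x ^ k * w x)) {n : ℕ} (hn : 1 ≤ n) :
    0 < secondMoment w P n := by
  have h := hP.isOrthonormalFor hw
  rw [secondMoment_eq hw]
  refine mul_pos (by positivity) (Finset.sum_pos (fun m _ => ?_) ⟨0, Finset.mem_range.2 hn⟩)
  rw [show X ^ 2 * P m * P m = (X * P m) * (X * P m) by ring]
  exact h.apply_mul_self_pos (mul_ne_zero X_ne_zero (h.ne_zero m))

lemma isProbDensity_rescale_oneLevel (hP : IsOrthonormalPolys w P) (hw0 : ∀ x, 0 ≤ w x)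
    (hw : ∀ k : ℕ, Integrable (fun x => x ^ k * w x)) {s : ℝ} (hs : 0 < s) {n : ℕ} (hn : 1 ≤ n) :
    IsProbDensity (rescale s n (oneLevel w P n)) where
  nonneg x := mul_nonneg (by positivity) (oneLevel_nonneg hw0 n _)
  integrable := by
    simpa using integrable_mul_rescale hs n (f := fun _ => 1)
      (by simpa using integrable_oneLevel (P := P) hw n)
  integral_eq_one := by
    have h := integral_mul_rescale hs n (fun _ => 1) (oneLevel w P n)
    simp only [one_mul] at h
    have : (n : ℝ) ≠ 0 := by positivity
    rw [h, integral_oneLevel hP hw, one_div_mul_cancel this]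

/-- Convergence of the moments of the rescaled level densities. -/
lemma tendsto_moment_rescale_oneLevel (hP : IsOrthonormalPolys w P)
    (hw : ∀ k : ℕ, Integrable (fun x => x ^ k * w x)) {ξ ζ t : ℝ}
    (hgrowth : ExpGrowth ξ ζ t (recAlpha P) (recBeta P)) (k : ℕ) :
    Tendsto (fun n => ∫ x, x ^ k * rescale √(secondMoment w P n) n (oneLevel w P n) x) atTop
      (𝓝 (levelMoment ξ ζ t k)) := by
  have h := hP.isOrthonormalFor hw
  obtain ⟨hα, hβ⟩ := hgrowth.tendsto_div_rpow
  obtain ⟨hξ, -, ht, -⟩ := hgrowth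
  have hS : ∀ k : ℕ, Tendsto (fun n : ℕ => (1 / (n : ℝ) * ∑ m ∈ Finset.range n,
      momentFunctional w hw (X ^ k * P m * P m)) / (n : ℝ) ^ ((k : ℝ) * t)) atTop
      (𝓝 (walkWeight ξ ζ k 0 / ((k : ℝ) * t + 1))) := fun k => by
    refine tendsto_sum_of_tendsto_div_rpow (by positivity) ?_
    simpa using h.tendsto_apply_X_pow_mul hα hβ k 0
  -- The case of exponent 2 gives D_n ~ n^{2t} (2ξ² + ζ²)/(2t+1), so the powers of n cancel in the
  -- normalized moments.
  have hD := hS 2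
  simp only [← secondMoment_eq hw] at hD
  have hw2 : walkWeight ξ ζ 2 0 = 2 * ξ ^ 2 + ζ ^ 2 := by
    rw [walkWeight_apply_zero]
    simp [Finset.sum_range_succ]
    ring
  have hr : 0 < 2 * ξ ^ 2 + ζ ^ 2 := by positivity
  have ht1 : 0 < 2 * t + 1 := by positivity
  rw [hw2] at hD
  have hk : ∀ a : ℝ, 0 ≤ a → a ^ ((k : ℝ) / 2) = √a ^ k := fun a ha => by
    rw [Real.sqrt_eq_rpow, ← Real.rpow_natCast, ← Real.rpow_mul ha]
    congr 1
    ring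
  have hlim := (hS k).div (hD.sqrt.pow k) (by push_cast; positivity)
  have e : levelMoment ξ ζ t k = walkWeight ξ ζ k 0 / ((k : ℝ) * t + 1)
      / √((2 * ξ ^ 2 + ζ ^ 2) / (((2 : ℕ) : ℝ) * t + 1)) ^ k := by
    rw [levelMoment, ← walkWeight_apply_zero, hk _ hr.le, hk _ ht1.le, Nat.cast_ofNat,
      Real.sqrt_div hr.le, div_pow]
    have := (Real.sqrt_pos.2 hr).ne'
    have := (Real.sqrt_pos.2 ht1).ne'
    have : (k : ℝ) * t + 1 ≠ 0 := by positivity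
    field_simp
  rw [e]
  refine hlim.congr' ?_
  filter_upwards [eventually_ge_atTop 1] with n hn
  have hn0 : 0 < (n : ℝ) := by exact_mod_cast hn
  have hs := Real.sqrt_pos.2 (secondMoment_pos hP hw hn)
  have hnt : 0 < (n : ℝ) ^ ((k : ℝ) * t) := Real.rpow_pos_of_pos hn0 _
  have hsq : √((n : ℝ) ^ (((2 : ℕ) : ℝ) * t)) ^ k = (n : ℝ) ^ ((k : ℝ) * t) := by
    rw [← hk _ (by positivity), ← Real.rpow_mul hn0.le]
    congr 1
    push_cast
    ring
  rw [integral_mul_rescale hs n (fun x => x ^ k)]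
  simp only [div_pow, div_mul_eq_mul_div, integral_div]
  rw [integral_pow_mul_oneLevel hw, Pi.div_apply, Real.sqrt_div (secondMoment_pos hP hw hn).le,
    div_pow, hsq]
  field_simp

lemma levelMoment_zero {ξ ζ t : ℝ} : levelMoment ξ ζ t 0 = 1 := by
  simp [levelMoment]

lemma weaklyConverges_rescale_oneLevel (hP : IsOrthonormalPolys w P) (hw0 : ∀ x, 0 ≤ w x)
    (hw : ∀ k : ℕ, Integrable (fun x => x ^ k * w x)) {ξ ζ t : ℝ}
    (hgrowth : ExpGrowth ξ ζ t (recAlpha P) (recBeta P)) {σ : ℝ → ℝ}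
    (hσ : IsLevelDensity ξ ζ t σ) :
    WeaklyConverges (fun n => rescale √(secondMoment w P n) n (oneLevel w P n)) σ := by
  have hσm : ∀ k : ℕ, Integrable (fun x => x ^ k * σ x) ∧
      ∫ x, x ^ k * σ x = levelMoment ξ ζ t k := by
    intro k
    rcases Nat.eq_zero_or_pos k with rfl | hk
    · simpa [levelMoment_zero] using ⟨hσ.1.integrable, hσ.1.integral_eq_one⟩
    · exact hσ.2 k hk
  refine weaklyConverges_of_moments
    (fun n x => mul_nonneg (by positivity) (oneLevel_nonneg hw0 n _)) (fun n k => ?_)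
    hσ.1.nonneg (fun k => (hσm k).1)
    (fun k => (hσm k).2 ▸ abs_levelMoment_le hgrowth.2.2.1 k)
    (fun k => (hσm k).2 ▸ tendsto_moment_rescale_oneLevel hP hw hgrowth k)
  -- For `n = 0` division by zero makes the density vanish, so integrability holds there too.
  rcases Nat.eq_zero_or_pos n with rfl | hn
  · simp [rescale]
  · refine integrable_mul_rescale (Real.sqrt_pos.2 (secondMoment_pos hP hw hn)) n
      (f := fun x => x ^ k) ?_
    simp only [div_pow, div_mul_eq_mul_div]
    exact (integrable_pow_mul_oneLevel hw n k).div_const _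

/-! ### Comparison of the perturbed and unperturbed densities -/

/-- The level density of the perturbed ensemble is dominated by an unperturbed one. -/
lemma oneLevel_perturbedWeight_le (hw : IsNormalizedWeight w) (hP : IsOrthonormalPolys w P)
    {q : ℝ[X]} {Q : ℕ → ℝ[X]} (hQ : IsOrthonormalPolys (perturbedWeight w q) Q) (n : ℕ) (x : ℝ) :
    oneLevel (perturbedWeight w q) Q n x ≤ oneLevel w P (n + q.natDegree) x := by
  have h := (hP.isOrthonormalFor hw.integrable_pow).sum_sq_eval_le (F := fun j => q * Q j) (n := n)
    (N := n + q.natDegree) (fun j hj => ?_) (fun i j => ?_) x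
  · simp only [oneLevel, ← Finset.sum_mul, perturbedWeight]
    rw [← mul_assoc, Finset.sum_mul]
    refine mul_le_mul_of_nonneg_right (le_trans (le_of_eq ?_) h) (hw.nonneg x)
    exact Finset.sum_congr rfl fun j _ => by rw [eval_mul]; ring
  · rw [degree_mul, hQ.degree_eq]
    calc q.degree + (j : WithBot ℕ) ≤ (q.natDegree : WithBot ℕ) + (j : WithBot ℕ) := by
          gcongr; exact degree_le_natDegree
      _ < ((n + q.natDegree : ℕ) : WithBot ℕ) := by exact_mod_cast (by omega)
  · rw [← hQ.orthonormal i j, momentFunctional_apply]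
    congr 1
    ext x
    simp only [eval_mul, perturbedWeight]
    ring

lemma oneLevel_le_add (hw0 : ∀ x, 0 ≤ w x) (n d : ℕ) (x : ℝ) :
    oneLevel w P n x ≤ oneLevel w P (n + d) x :=
  Finset.sum_le_sum_of_subset_of_nonneg (Finset.range_subset_range.2 (Nat.le_add_right n d))
    fun _ _ _ => mul_nonneg (sq_nonneg _) (hw0 x)

end OneLevel

/-- For ordered functions the L¹ distance is the difference of masses, and the substitution y = x s
removes the scale from the bound. -/
lemma abs_integral_mul_sub_le {f g : ℝ → ℝ} (hf : Integrable f) (hg : Integrable g)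
    (hfg : ∀ x, f x ≤ g x) (φ : ℝ →ᵇ ℝ) {s : ℝ} (hs : 0 < s) (n : ℕ) :
    |(∫ x, φ x * rescale s n g x) - ∫ x, φ x * rescale s n f x|
      ≤ ‖φ‖ * ((∫ x, g x) - ∫ x, f x) / n := by
  have hcont : Continuous fun y => φ (y / s) := by fun_prop
  have hint : ∀ {u : ℝ → ℝ}, Integrable u → Integrable fun y => φ (y / s) * u y := fun hu =>
    hu.bdd_mul hcont.aestronglyMeasurable (Eventually.of_forall fun y => φ.norm_coe_le_norm _)
  rw [integral_mul_rescale hs, integral_mul_rescale hs, ← mul_sub, ← integral_sub (hint hg) (hint hf),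
    abs_mul, abs_of_nonneg (by positivity : 0 ≤ 1 / (n : ℝ)), ← integral_sub hg hf, mul_comm,
    mul_one_div, ← integral_const_mul]
  gcongr
  refine abs_integral_le_integral_abs.trans (integral_mono_of_nonneg
    (Eventually.of_forall fun _ => abs_nonneg _) ((hg.sub hf).const_mul _)
    (Eventually.of_forall fun x => ?_))
  simp only
  rw [← mul_sub, abs_mul, abs_of_nonneg (sub_nonneg.2 (hfg x))]
  exact mul_le_mul_of_nonneg_right (φ.norm_coe_le_norm _) (sub_nonneg.2 (hfg x))

end LevelDensity

end

theorem theorem4p6 (w : ℝ → ℝ) (hw : LevelDensity.IsNormalizedWeight w)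
    (P : ℕ → Polynomial ℝ) (hP : LevelDensity.IsOrthonormalPolys w P)
    (ξ ζ t : ℝ)
    (hgrowth : LevelDensity.ExpGrowth ξ ζ t (LevelDensity.recAlpha P) (LevelDensity.recBeta P))
    (σ : ℝ → ℝ) (hσ : LevelDensity.IsLevelDensity ξ ζ t σ)
    (q : Polynomial ℝ) (hq : q ≠ 0)
    (Q : ℕ → Polynomial ℝ)
    (hQ : LevelDensity.IsOrthonormalPolys (LevelDensity.perturbedWeight w q) Q) :
    (∀ n : ℕ, 1 ≤ n →
      LevelDensity.IsProbDensity (LevelDensity.perturbedDensity w P q Q n)) ∧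
    LevelDensity.WeaklyConverges (LevelDensity.perturbedDensity w P q Q) σ := by
  have hw' := hw.perturbedWeight_integrable_pow q
  have hs : ∀ n : ℕ, 1 ≤ n → 0 < √(LevelDensity.secondMoment w P n) := fun n hn =>
    Real.sqrt_pos.2 (LevelDensity.secondMoment_pos hP hw.integrable_pow hn)
  refine ⟨fun n hn => LevelDensity.isProbDensity_rescale_oneLevel hQ
    (fun x => mul_nonneg (sq_nonneg _) (hw.nonneg x)) hw' (hs n hn) hn, fun φ => ?_⟩
  have hconv := LevelDensity.weaklyConverges_rescale_oneLevel hP hw.nonneg hw.integrable_pow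
    hgrowth hσ φ
  -- The bound is a triangle inequality through R_{n+d}, rescaled by √D_n rather than √D_{n+d}; each
  -- leg has excess mass d.
  refine tendsto_of_tendsto_of_dist hconv (squeeze_zero' (Eventually.of_forall fun _ => dist_nonneg)
    (g := fun n : ℕ => 2 * ‖φ‖ * q.natDegree * (1 / (n : ℝ))) ?_ ?_)
  · filter_upwards [eventually_ge_atTop 1] with n hn
    have hi := fun m => LevelDensity.integrable_oneLevel (P := P) hw.integrable_pow m
    have h1 := LevelDensity.abs_integral_mul_sub_le (LevelDensity.integrable_oneLevel hw' n)
      (hi (n + q.natDegree)) (LevelDensity.oneLevel_perturbedWeight_le hw hP hQ n) φ (hs n hn) n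
    have h2 := LevelDensity.abs_integral_mul_sub_le (hi n) (hi (n + q.natDegree))
      (LevelDensity.oneLevel_le_add hw.nonneg n q.natDegree) φ (hs n hn) n
    simp only [LevelDensity.integral_oneLevel hP hw.integrable_pow,
      LevelDensity.integral_oneLevel hQ hw', Nat.cast_add, add_sub_cancel_left] at h1 h2
    rw [Real.dist_eq]
    have e : 2 * ‖φ‖ * q.natDegree * (1 / (n : ℝ))
        = ‖φ‖ * q.natDegree / n + ‖φ‖ * q.natDegree / n := by ring
    rw [e]
    rw [abs_sub_comm] at h2
    refine le_trans (le_of_eq ?_) ((abs_add_le _ _).trans (add_le_add h2 h1))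
    congr 1
    change _ - (∫ x, φ x * LevelDensity.rescale _ n _ x) = _
    ring
  · simpa using (tendsto_one_div_atTop_nhds_zero_nat (𝕜 := ℝ)).const_mul
      (2 * ‖φ‖ * (q.natDegree : ℝ))
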